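/- Let $\mathrm{DNF}_n$ be the class of Boolean functions on $\{0,1\}^n$ that are computed by DNF formulas of size at most $n$, where the size of a DNF formula is its number of terms. For a distribution $D$ over a set $X$, $k\in\mathbb N$ and $\tau>0$, a $k$-wise statistical query oracle $\mathsf{STAT}^{(k)}_D(\tau)$ answers every query $\phi:X^k\to[-1,1]$ with some value $v$ such that $|v-\mathbb E_{x\sim D^k}[\phi(x)]|\le\tau$. A (possibly randomized and adaptive) algorithm with access to $\mathsf{STAT}^{(k)}(\tau)$ PAC learns $\mathrm{DNF}_n$ with error $<\epsilon$ and success probability at least $2/3$ if for every distribution $P$ over $\{0,1\}^n$, every $f\in\mathrm{DNF}_n$ and every valid oracle $\mathsf{STAT}^{(k)}_{P^f}(\tau)$, where $P^f$ is the distribution of $(x,f(x))$ for $x\sim P$, it outputs, with probability at least $2/3$ over its internal randomness, a hypothesis $h:\{0,1\}^n\to\{0,1\}$ with $\Pr_{x\sim P}[h(x)\ne f(x)]<\epsilon$. Theorem. For every constant $\alpha>0$ there is a constant $\beta>0$ such that for every integer $n\ge 1$, any algorithm that, with access to $\mathsf{STAT}^{(k)}(n^{-\beta\log_2 n})$ for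 $k=\lceil n^{1-\alpha}\rceil$, PAC learns $\mathrm{DNF}_n$ with error $<1/2-n^{-\beta\log_2 n}$ and success probability at least $2/3$ needs at least $2^{n^{1-\alpha}}$ queries: if it never asks more than $q$ queries, then $q\ge 2^{n^{1-\alpha}}$. -/

import Mathlib

open MeasureTheory

noncomputable section

/-! ### DNF formulas -/

/-- A DNF formula over the Boolean variables `x 0, …, x (n-1)`: a finite set of terms, each term
being a finite set of literals; the literal `(i, b)` is satisfied by `x` iff `x i = b`. -/
abbrev DNF (n : ℕ) : Type := Finset (Finset (Fin n × Bool))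

namespace DNF

/-- The size of a DNF formula is its number of terms. -/
def size {n : ℕ} (F : DNF n) : ℕ := F.card

/-- The Boolean function computed by a DNF formula (a disjunction of conjunctions). -/
def eval {n : ℕ} (F : DNF n) (x : Fin n → Bool) : Bool :=
  decide (∃ t ∈ F, ∀ l ∈ t, x l.1 = l.2)

/-- The concept class of functions on `{0,1}^n` computed by DNF formulas of size at most `s`. -/
def conceptClass (n s : ℕ) : Set ((Fin n → Bool) → Bool) :=
  {f | ∃ F : DNF n, F.size ≤ s ∧ F.eval = f}

end DNF

/-! ### `k`-wise statistical queries -/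

/-- A `k`-wise query function `X^k → [-1, 1]`. -/
abbrev KWiseQuery (X : Type) (k : ℕ) : Type := (Fin k → X) → Set.Icc (-1 : ℝ) 1

/-- `O` is a `k`-wise statistical query oracle for the distribution `D` with tolerance `τ`:
it answers every query `φ` by some value within `τ` of the expectation of `φ` under `D^k`. -/
def IsSTAT {X : Type} [MeasurableSpace X] (k : ℕ) (D : Measure X) (τ : ℝ)
    (O : KWiseQuery X k → ℝ) : Prop :=
  ∀ φ : KWiseQuery X k, |O φ - ∫ x, (φ x : ℝ) ∂(Measure.pi fun _ : Fin k => D)| ≤ τ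

/-- A deterministic adaptive algorithm that asks `k`-wise queries over `X` and outputs an element
of `H`: either it stops with an output, or it asks a query and continues according to the answer.
There is no restriction on the computation between queries. -/
inductive SQAlg (X : Type) (k : ℕ) (H : Type) : Type
  | output (h : H) : SQAlg X k H
  | query (φ : KWiseQuery X k) (next : ℝ → SQAlg X k H) : SQAlg X k H

namespace SQAlg

/-- The output of the algorithm when its queries are answered by `O`. -/
def run {X : Type} {k : ℕ} {H : Type} (O : KWiseQuery X k → ℝ) : SQAlg X k H → H
  | output h => h
  | query φ next => run O (next (O φ))

/-- The number of queries asked by the algorithm when its queries are answered by `O`. -/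
def numQueries {X : Type} {k : ℕ} {H : Type} (O : KWiseQuery X k → ℝ) : SQAlg X k H → ℕ
  | output _ => 0
  | query φ next => numQueries O (next (O φ)) + 1

end SQAlg

/-! ### PAC learning from `k`-wise statistical queries -/

/-- The distribution of the labeled example `(x, f x)` for `x ∼ P`. -/
def labeled {Z : Type} [MeasurableSpace Z] (P : Measure Z) (f : Z → Bool) : Measure (Z × Bool) :=
  P.map fun x => (x, f x)

/-- A randomized algorithm is a family `A` of deterministic algorithms indexed by the random seed
`ω ∼ μ`. It PAC learns the class `C` over `Z` from `k`-wise queries of tolerance `τ`, with error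
`< ε` and success probability at least `p`, if for every distribution `P` on `Z`, every target
`f ∈ C` and every valid oracle for the labeled examples, with probability at least `p` over the
seed the output hypothesis `h` satisfies `Pr_{x ∼ P}[h x ≠ f x] < ε`.
(The event `E` is there only so that measurability of the exact success event is not needed.) -/
def PACLearns {Z : Type} [MeasurableSpace Z] {Ω : Type*} [MeasurableSpace Ω] {k : ℕ}
    (C : Set (Z → Bool)) (τ ε p : ℝ) (μ : Measure Ω)
    (A : Ω → SQAlg (Z × Bool) k (Z → Bool)) : Prop :=
  ∀ (P : Measure Z) [IsProbabilityMeasure P], ∀ f ∈ C, ∀ O : KWiseQuery (Z × Bool) k → ℝ,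
    IsSTAT k (labeled P f) τ O →
      ∃ E : Set Ω, MeasurableSet E ∧ p ≤ μ.real E ∧
        ∀ ω ∈ E, P.real {x | (A ω).run O x ≠ f x} < ε

/-- On every input distribution `(x, f x)`, `x ∼ P`, `f ∈ C`, with every valid oracle of tolerance
`τ`, and for every seed, the algorithm asks at most `q` queries. -/
def UsesAtMost {Z : Type} [MeasurableSpace Z] {Ω : Type*} {k : ℕ}
    (C : Set (Z → Bool)) (τ : ℝ) (A : Ω → SQAlg (Z × Bool) k (Z → Bool)) (q : ℕ) : Prop :=
  ∀ (P : Measure Z) [IsProbabilityMeasure P], ∀ f ∈ C, ∀ O : KWiseQuery (Z × Bool) k → ℝ,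
    IsSTAT k (labeled P f) τ O → ∀ ω, (A ω).numQueries O ≤ q

end

/-!
Split the variables into `r ≈ log₂ n` blocks of `m` variables. An input encodes the choice of one
index in each block, a secret assigns a bit to every index, and the target is the parity of the `r`
secret bits at the chosen indices: on encodings, a DNF formula with `2 ^ r ≤ n` terms.

For uniformly random inputs, the labels of a random secret are hard to tell from independent random
labels. The `2k`-th moment, over the secrets, of the correlation of the target with a bounded `ψ` is
a combination of moments of independent Rademacher variables. These are all nonnegative, so `ψ = 1`
is the worst case, where the moment is a product over the blocks bounded by Khintchine's inequality.
Replacing the `k` samples of a query one at a time costs a further factor `k ^ (2k) * 2 ^ k`.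

By Markov's inequality each query thus distinguishes only few secrets from the random labels.
An oracle that answers as for random labels whenever it may reveals nothing about any other secret,
and a hypothesis with error below `1/2 - τ` itself yields a distinguishing query; so `2/3` of the
secrets must be covered by `q + 1` queries. For the finitely many remaining `n`, a small `β` makes
the tolerance at least `1/2`, and no hypothesis has error below `1/2 - τ ≤ 0`.
-/

section RademacherMoments

/-- The sign `(-1) ^ b` of a bit: the values of a uniformly random bit become a Rademacher
variable. -/
def boolSign (b : Bool) : ℝ := if b then -1 else 1

theorem prod_boolSign {ι : Type*} (t : Finset ι) (b : ι → Bool) :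
    ∏ j ∈ t, boolSign (b j) = (-1) ^ (t.filter fun j => b j).card := by
  simp only [boolSign, Finset.prod_ite, Finset.prod_const, one_pow, mul_one]

theorem sum_boolSign_pow_nonneg (n : ℕ) : 0 ≤ ∑ b, boolSign b ^ n := by
  rcases neg_one_pow_eq_or ℝ n with h | h <;> simp [boolSign, h]

variable {ι κ : Type*} [Fintype ι] [Fintype κ] [DecidableEq κ]

theorem sum_prod_boolSign_nonneg (c : ι → κ) :
    0 ≤ ∑ u : κ → Bool, ∏ a, boolSign (u (c a)) := by
  have group_equal_indices (u : κ → Bool) : ∏ a, boolSign (u (c a)) =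
      ∏ i, boolSign (u i) ^ (Finset.univ.filter fun a => c a = i).card := by
    rw [← Finset.prod_fiberwise Finset.univ c]
    refine Finset.prod_congr rfl fun i _ => Finset.prod_eq_pow_card fun a ha => ?_
    rw [(Finset.mem_filter.1 ha).2]
  simp_rw [group_equal_indices]
  rw [← Fintype.prod_sum fun i b => boolSign b ^ (Finset.univ.filter fun a => c a = i).card]
  exact Finset.prod_nonneg fun i _ => sum_boolSign_pow_nonneg _

variable [DecidableEq ι]

theorem sum_pow_sum_mul_prod_boolSign (θ : (ι → κ) → ℝ) (p : ℕ) :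
    ∑ s : ι → κ → Bool, (∑ c, θ c * ∏ j, boolSign (s j (c j))) ^ p =
      ∑ c : Fin p → ι → κ, (∏ a, θ (c a)) * ∏ j, ∑ u : κ → Bool, ∏ a, boolSign (u (c a j)) := by
  simp_rw [Fintype.sum_pow, Finset.prod_mul_distrib]
  rw [Finset.sum_comm]
  refine Finset.sum_congr rfl fun c _ => ?_
  rw [← Finset.mul_sum, Fintype.prod_sum fun j (u : κ → Bool) => ∏ a, boolSign (u (c a j))]
  exact congrArg _ (Finset.sum_congr rfl fun s _ => Finset.prod_comm)

-- All moments `∑ u, ∏ a, boolSign (u (c a j))` are nonnegative, so the coefficients `θ` may be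
-- replaced by `1`; the form then factors over the blocks `j`.
theorem sum_pow_sum_mul_prod_boolSign_le {θ : (ι → κ) → ℝ} (hθ : ∀ c, |θ c| ≤ 1) (p : ℕ) :
    ∑ s : ι → κ → Bool, (∑ c, θ c * ∏ j, boolSign (s j (c j))) ^ p ≤
      (∑ u : κ → Bool, (∑ i, boolSign (u i)) ^ p) ^ Fintype.card ι := by
  calc ∑ s : ι → κ → Bool, (∑ c, θ c * ∏ j, boolSign (s j (c j))) ^ p
      ≤ ∑ s : ι → κ → Bool, (∑ c : ι → κ, 1 * ∏ j, boolSign (s j (c j))) ^ p := by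
        rw [sum_pow_sum_mul_prod_boolSign, sum_pow_sum_mul_prod_boolSign fun _ => 1]
        refine Finset.sum_le_sum fun c _ => mul_le_mul_of_nonneg_right ?_
          (Finset.prod_nonneg fun j _ => sum_prod_boolSign_nonneg fun a => c a j)
        refine (le_abs_self _).trans ?_
        rw [Finset.abs_prod]
        exact Finset.prod_le_prod (fun _ _ => abs_nonneg _) fun _ _ => hθ _
    _ = ∑ s : ι → κ → Bool, ∏ j, (∑ i, boolSign (s j i)) ^ p := by
        simp only [one_mul, Finset.prod_pow, Fintype.prod_sum]
    _ = (∑ u : κ → Bool, (∑ i, boolSign (u i)) ^ p) ^ Fintype.card ι := by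
        rw [← Fintype.prod_sum fun _ (u : κ → Bool) => (∑ i, boolSign (u i)) ^ p,
          Finset.prod_const, Finset.card_univ]

theorem pow_two_mul_le_factorial_mul_cosh (x : ℝ) (t : ℕ) :
    x ^ (2 * t) ≤ (2 * t).factorial * Real.cosh x := by
  rw [← div_le_iff₀' (by positivity)]
  exact le_hasSum x.hasSum_cosh t fun i _ =>
    div_nonneg ((even_two_mul i).pow_nonneg x) (Nat.cast_nonneg _)

theorem sum_exp_mul_sum_boolSign (l : ℝ) :
    ∑ u : κ → Bool, Real.exp (l * ∑ i, boolSign (u i)) = (2 * Real.cosh l) ^ Fintype.card κ := by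
  simp_rw [Finset.mul_sum, Real.exp_sum]
  rw [← Fintype.prod_sum fun _ b => Real.exp (l * boolSign b), Finset.prod_const, Finset.card_univ]
  simp [boolSign, Real.cosh_eq, mul_div_cancel₀, add_comm]

theorem sum_cosh_mul_sum_boolSign (l : ℝ) :
    ∑ u : κ → Bool, Real.cosh (l * ∑ i, boolSign (u i)) = (2 * Real.cosh l) ^ Fintype.card κ := by
  simp_rw [Real.cosh_eq (_ * _), ← neg_mul]
  rw [← Finset.sum_div, Finset.sum_add_distrib, sum_exp_mul_sum_boolSign,
    sum_exp_mul_sum_boolSign, Real.cosh_neg, add_self_div_two]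

theorem pow_mul_sum_pow_sum_boolSign_le (l : ℝ) (t : ℕ) :
    l ^ (2 * t) * ∑ u : κ → Bool, (∑ i, boolSign (u i)) ^ (2 * t) ≤
      (2 * t).factorial * (2 ^ Fintype.card κ * Real.exp (Fintype.card κ * (l ^ 2 / 2))) := by
  calc l ^ (2 * t) * ∑ u : κ → Bool, (∑ i, boolSign (u i)) ^ (2 * t)
      = ∑ u : κ → Bool, (l * ∑ i, boolSign (u i)) ^ (2 * t) := by
        simp only [mul_pow, ← Finset.mul_sum]
    _ ≤ ∑ u : κ → Bool, (2 * t).factorial * Real.cosh (l * ∑ i, boolSign (u i)) :=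
        Finset.sum_le_sum fun u _ => pow_two_mul_le_factorial_mul_cosh _ t
    _ = (2 * t).factorial * (2 ^ Fintype.card κ * Real.cosh l ^ Fintype.card κ) := by
        rw [← Finset.mul_sum, sum_cosh_mul_sum_boolSign, mul_pow]
    _ ≤ (2 * t).factorial * (2 ^ Fintype.card κ * Real.exp (l ^ 2 / 2) ^ Fintype.card κ) := by
        gcongr
        exact Real.cosh_le_exp_half_sq l
    _ = _ := by rw [Real.exp_nat_mul]

theorem sum_pow_two_mul_sum_boolSign_le (t : ℕ) :
    ∑ u : κ → Bool, (∑ i, boolSign (u i)) ^ (2 * t) ≤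
      2 ^ Fintype.card κ * (6 * t * Fintype.card κ) ^ t := by
  rcases t.eq_zero_or_pos with rfl | ht
  · simp
  rcases isEmpty_or_nonempty κ with _ | _
  · simp [ht.ne']
  set m : ℝ := (Fintype.card κ : ℝ)
  have hm : 0 < m := Nat.cast_pos.2 Fintype.card_pos
  have : (0 : ℝ) < t := Nat.cast_pos.2 ht
  -- This choice of `l` minimizes `exp (m * l ^ 2 / 2) / l ^ (2 * t)`.
  set l : ℝ := √(2 * t / m)
  have hl : l ^ 2 = 2 * t / m := Real.sq_sqrt (by positivity)
  have hl_pow : l ^ (2 * t) = (2 * t / m) ^ t := by rw [pow_mul, hl]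
  have hexp : Real.exp (m * (l ^ 2 / 2)) ≤ 3 ^ t := by
    rw [show m * (l ^ 2 / 2) = t * 1 by rw [hl]; field_simp, Real.exp_nat_mul]
    exact pow_le_pow_left₀ (Real.exp_pos _).le Real.exp_one_lt_three.le _
  have hfactorial : ((2 * t).factorial : ℝ) ≤ (2 * t) ^ (2 * t) := by
    exact_mod_cast Nat.factorial_le_pow (2 * t)
  refine le_of_mul_le_mul_left ?_ (show 0 < l ^ (2 * t) by rw [hl_pow]; positivity)
  calc l ^ (2 * t) * ∑ u : κ → Bool, (∑ i, boolSign (u i)) ^ (2 * t)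
      ≤ (2 * t).factorial * (2 ^ Fintype.card κ * Real.exp (m * (l ^ 2 / 2))) :=
        pow_mul_sum_pow_sum_boolSign_le l t
    _ ≤ (2 * t) ^ (2 * t) * (2 ^ Fintype.card κ * 3 ^ t) := by gcongr
    _ = l ^ (2 * t) * (2 ^ Fintype.card κ * (6 * t * m) ^ t) := by
        rw [hl_pow, pow_mul, mul_left_comm, mul_left_comm ((2 * t / m : ℝ) ^ t), ← mul_pow,
          ← mul_pow]
        congr 2
        field_simp
        norm_num

end RademacherMoments

section ManySamples

open scoped NNReal

theorem sum_add_pow_le_of_even {S : Type*} [Fintype S] {p : ℕ} (hp : Even p) (hp0 : p ≠ 0)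
    {f g : S → ℝ} {x y M : ℝ} (hx : 0 ≤ x) (hy : 0 ≤ y) (hM : 0 ≤ M)
    (hf : ∑ s, f s ^ p ≤ x ^ p * M) (hg : ∑ s, g s ^ p ≤ y ^ p * M) :
    ∑ s, (f s + g s) ^ p ≤ (x + y) ^ p * M := by
  have sum_nonneg (h : S → ℝ) : 0 ≤ ∑ s, h s ^ p := Finset.sum_nonneg fun s _ => hp.pow_nonneg _
  have root_le {h : S → ℝ} {z : ℝ} (hz : 0 ≤ z) (hh : ∑ s, h s ^ p ≤ z ^ p * M) :
      (∑ s, h s ^ p) ^ (p⁻¹ : ℝ) ≤ z * M ^ (p⁻¹ : ℝ) := by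
    refine (Real.rpow_le_rpow (sum_nonneg h) hh (by positivity)).trans_eq ?_
    rw [Real.mul_rpow (by positivity) hM, Real.pow_rpow_inv_natCast hz hp0]
  have minkowski := Real.Lp_add_le Finset.univ f g (p := p)
    (by exact_mod_cast Nat.one_le_iff_ne_zero.2 hp0)
  simp only [Real.rpow_natCast, hp.pow_abs, one_div] at minkowski
  calc ∑ s, (f s + g s) ^ p = ((∑ s, (f s + g s) ^ p) ^ (p⁻¹ : ℝ)) ^ p :=
        (Real.rpow_inv_natCast_pow (sum_nonneg _) hp0).symm
    _ ≤ ((x + y) * M ^ (p⁻¹ : ℝ)) ^ p := by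
        refine pow_le_pow_left₀ (Real.rpow_nonneg (sum_nonneg _) _) ?_ p
        rw [add_mul]
        exact minkowski.trans (add_le_add (root_le hx hf) (root_le hy hg))
    _ = (x + y) ^ p * M := by rw [mul_pow, Real.rpow_inv_natCast_pow hM hp0]

variable {Y : Type*} [MeasurableSpace Y]

theorem integrable_of_abs_le {μ : Measure Y} [IsFiniteMeasure μ] {f : Y → ℝ} (hf : Measurable f)
    {b : ℝ} (hb : ∀ y, |f y| ≤ b) : Integrable f μ :=
  .of_bound hf.aestronglyMeasurable b (.of_forall hb)

theorem abs_integral_le_of_abs_le {μ : Measure Y} [IsProbabilityMeasure μ] {f : Y → ℝ} {b : ℝ}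
    (hb : ∀ y, |f y| ≤ b) : |∫ y, f y ∂μ| ≤ b := by
  simpa using norm_integral_le_of_norm_le_const (μ := μ) (f := f) (.of_forall hb)

theorem integral_pi_succ (D : Measure Y) [SigmaFinite D] {k : ℕ} {φ : (Fin (k + 1) → Y) → ℝ}
    (hφ : Integrable φ (Measure.pi fun _ => D)) :
    ∫ y, φ y ∂(Measure.pi fun _ => D) =
      ∫ z, ∫ y, φ (Fin.cons z y) ∂(Measure.pi fun _ => D) ∂D := by
  have hcons := (measurePreserving_piFinSuccAbove (fun _ : Fin (k + 1) => D) 0).symm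
  rw [← hcons.integral_comp', integral_prod (fun x => φ _) (hcons.integrable_comp_of_integrable hφ)]
  simp [MeasurableEquiv.piFinSuccAbove_symm_apply, Fin.insertNthEquiv]

theorem measurable_finCons {k : ℕ} :
    Measurable fun x : Y × (Fin k → Y) => (Fin.cons x.1 x.2 : Fin (k + 1) → Y) :=
  measurable_pi_lambda _ <| Fin.cases (by simpa only [Fin.cons_zero] using measurable_fst)
    fun i => by simp only [Fin.cons_succ]; fun_prop

theorem measurable_integral_cons (D : Measure Y) [SigmaFinite D] {k : ℕ}
    {φ : (Fin (k + 1) → Y) → ℝ} (hφ : Measurable φ) :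
    Measurable fun z => ∫ y, φ (Fin.cons z y) ∂(Measure.pi fun _ => D) :=
  (hφ.comp measurable_finCons).stronglyMeasurable.integral_prod_right'.measurable

theorem sum_pow_integral_le {S : Type*} [Fintype S] {D : S → Measure Y}
    [∀ s, IsProbabilityMeasure (D s)] {D₀ : Measure Y} [IsProbabilityMeasure D₀] {c : ℝ≥0}
    (hD : ∀ s, D s ≤ c • D₀) {p : ℕ} (hp : Even p) {g : S → Y → ℝ} (hg : ∀ s, Measurable (g s))
    {b : ℝ} (hb : ∀ s y, |g s y| ≤ b) {M : ℝ} (hM : ∀ y, ∑ s, g s y ^ p ≤ M) :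
    ∑ s, (∫ y, g s y ∂D s) ^ p ≤ c * M := by
  have hint (s : S) (μ : Measure Y) [IsFiniteMeasure μ] : Integrable (fun y => g s y ^ p) μ :=
    integrable_of_abs_le ((hg s).pow_const p) fun y =>
      (abs_pow _ _).trans_le (pow_le_pow_left₀ (abs_nonneg _) (hb s y) p)
  calc ∑ s, (∫ y, g s y ∂D s) ^ p ≤ ∑ s, ∫ y, g s y ^ p ∂D s :=
        Finset.sum_le_sum fun s _ => hp.convexOn_pow.map_integral_le
          (continuous_pow p).continuousOn isClosed_univ (.of_forall fun _ => Set.mem_univ _)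
          (integrable_of_abs_le (hg s) (hb s)) (hint s _)
    _ ≤ ∑ s, ∫ y, g s y ^ p ∂(c • D₀) :=
        Finset.sum_le_sum fun s _ => integral_mono_measure (hD s)
          (.of_forall fun y => hp.pow_nonneg _) (hint s _)
    _ = c * ∫ y, ∑ s, g s y ^ p ∂D₀ := by
        simp_rw [integral_smul_nnreal_measure, NNReal.smul_def, smul_eq_mul]
        rw [← Finset.mul_sum, integral_finsetSum _ fun s _ => hint s _]
    _ ≤ c * M := by
        gcongr
        refine (integral_mono (integrable_finsetSum _ fun s _ => hint s _)
          (integrable_const M) hM).trans_eq ?_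
        simp

theorem sum_pow_integral_pi_sub_le {S : Type*} [Fintype S] {D : S → Measure Y}
    [∀ s, IsProbabilityMeasure (D s)] {D₀ : Measure Y} [IsProbabilityMeasure D₀] {c : ℝ≥0}
    (hc : 1 ≤ c) (hD : ∀ s, D s ≤ c • D₀) {p : ℕ} (hp : Even p) (hp0 : p ≠ 0) {B : ℝ}
    (hB : ∀ ψ : Y → ℝ, Measurable ψ → (∀ y, |ψ y| ≤ 1) →
      ∑ s, (∫ y, ψ y ∂D s - ∫ y, ψ y ∂D₀) ^ p ≤ B)
    {k : ℕ} {φ : (Fin k → Y) → ℝ} (hφm : Measurable φ) (hφ : ∀ y, |φ y| ≤ 1) :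
    ∑ s, (∫ y, φ y ∂(Measure.pi fun _ => D s) - ∫ y, φ y ∂(Measure.pi fun _ => D₀)) ^ p ≤
      (k : ℝ) ^ p * (c ^ k * B) := by
  have hB0 : 0 ≤ B := (Finset.sum_nonneg fun s _ => hp.pow_nonneg _).trans
    (hB (fun _ => 0) measurable_const fun _ => by simp)
  induction k with
  | zero => simp [integral_unique, hp0]
  | succ k ih =>
    let tail (μ : Measure Y) (z : Y) : ℝ := ∫ y, φ (Fin.cons z y) ∂(Measure.pi fun _ => μ)
    have htail_meas (μ : Measure Y) [SigmaFinite μ] : Measurable (tail μ) :=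
      measurable_integral_cons μ hφm
    have htail (μ : Measure Y) [IsProbabilityMeasure μ] (z : Y) : |tail μ z| ≤ 1 :=
      abs_integral_le_of_abs_le fun _ => hφ _
    -- Hybrid argument: first the last `k` samples are replaced, then the first one.
    have hsplit (s : S) :
        ∫ y, φ y ∂(Measure.pi fun _ => D s) - ∫ y, φ y ∂(Measure.pi fun _ => D₀) =
          ∫ z, (tail (D s) z - tail D₀ z) ∂D s + (∫ z, tail D₀ z ∂D s - ∫ z, tail D₀ z ∂D₀) := by
      rw [integral_pi_succ _ (integrable_of_abs_le hφm hφ),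
        integral_pi_succ _ (integrable_of_abs_le hφm hφ),
        integral_sub (integrable_of_abs_le (htail_meas _) (htail _))
          (integrable_of_abs_le (htail_meas _) (htail _))]
      ring
    have hlast : ∑ s, (∫ z, (tail (D s) z - tail D₀ z) ∂D s) ^ p ≤
        (k : ℝ) ^ p * (c ^ (k + 1) * B) := by
      refine (sum_pow_integral_le hD hp (fun s => (htail_meas (D s)).sub (htail_meas D₀))
        (fun s z => (abs_sub _ _).trans (add_le_add (htail (D s) z) (htail D₀ z)))
        fun z => ih (hφm.comp (measurable_finCons.comp measurable_prodMk_left))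
          fun _ => hφ _).trans_eq (by ring)
    have hfirst : ∑ s, (∫ z, tail D₀ z ∂D s - ∫ z, tail D₀ z ∂D₀) ^ p ≤
        1 ^ p * (c ^ (k + 1) * B) := by
      rw [one_pow, one_mul]
      exact (hB _ (htail_meas D₀) (htail D₀)).trans
        (le_mul_of_one_le_left hB0 (one_le_pow₀ (by exact_mod_cast hc)))
    simp_rw [hsplit, Nat.cast_succ]
    exact sum_add_pow_le_of_even hp hp0 k.cast_nonneg zero_le_one (by positivity) hlast hfirst

end ManySamples

section QueryLowerBound

variable {X H : Type} {S : Type*} {k : ℕ}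

namespace SQAlg

/-- The queries asked by the algorithm, in order, when its queries are answered by `O`. -/
def queries (O : KWiseQuery X k → ℝ) : SQAlg X k H → List (KWiseQuery X k)
  | output _ => []
  | query φ next => φ :: queries O (next (O φ))

-- Only the first `q` queries of the run with `O'` matter: with the answers of `O'` the algorithm
-- may ask more queries, even if it asks at most `q` with those of `O`.
theorem run_eq_run {O O' : KWiseQuery X k → ℝ} {a : SQAlg X k H} {q : ℕ}
    (hq : a.numQueries O ≤ q) (hO : ∀ φ ∈ (a.queries O').take q, O φ = O' φ) :
    a.run O = a.run O' := by
  induction a generalizing q with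
  | output h => rfl
  | query φ next ih =>
    obtain ⟨q, rfl⟩ : ∃ q', q = q' + 1 := Nat.exists_eq_succ_of_ne_zero fun hq0 => by
      simp [numQueries, hq0] at hq
    simp only [queries, List.take_succ_cons, List.mem_cons, forall_eq_or_imp] at hO
    obtain ⟨hφ, hO⟩ := hO
    simp only [numQueries, hφ, Nat.add_le_add_iff_right] at hq
    simp only [run, hφ]
    exact ih _ hq hO

end SQAlg

variable [MeasurableSpace X]

/-- The expectation of the query `φ` under `k` independent samples from `D`. -/
noncomputable def kWiseExpect (D : Measure X) (φ : KWiseQuery X k) : ℝ :=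
  ∫ x, (φ x : ℝ) ∂(Measure.pi fun _ => D)

/-- The query `φ` distinguishes `D` from the reference distribution `D₀` at tolerance `τ`:
the expectation of `φ` under `D₀` is not a valid answer for `D`. -/
def Distinguishes (τ : ℝ) (D₀ D : Measure X) (φ : KWiseQuery X k) : Prop :=
  τ < |kWiseExpect D₀ φ - kWiseExpect D φ|

open Classical in
/-- The oracle for `D` that answers as if the distribution were `D₀` whenever it may, so that it
reveals `D` only to distinguishing queries. -/
noncomputable def reluctantOracle (τ : ℝ) (D₀ D : Measure X) (φ : KWiseQuery X k) : ℝ :=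
  if Distinguishes τ D₀ D φ then kWiseExpect D φ else kWiseExpect D₀ φ

theorem isSTAT_reluctantOracle {τ : ℝ} (hτ : 0 ≤ τ) (D₀ D : Measure X) :
    IsSTAT k D τ (reluctantOracle τ D₀ D) := by
  intro φ
  change |reluctantOracle τ D₀ D φ - kWiseExpect D φ| ≤ τ
  rw [reluctantOracle]
  split_ifs with h
  · simpa using hτ
  · exact not_lt.1 h

theorem SQAlg.run_reluctantOracle {τ : ℝ} {D₀ D : Measure X} {a : SQAlg X k H} {q : ℕ}
    (hq : a.numQueries (reluctantOracle τ D₀ D) ≤ q)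
    (hD : ∀ φ ∈ (a.queries (kWiseExpect D₀)).take q, ¬ Distinguishes τ D₀ D φ) :
    a.run (reluctantOracle τ D₀ D) = a.run (kWiseExpect D₀) :=
  SQAlg.run_eq_run hq fun φ hφ => if_neg (hD φ hφ)

open scoped Finset

variable [Fintype S]

open Classical in
theorem SQAlg.card_run_reluctantOracle_le {τ δ : ℝ} {D₀ : Measure X} {D : S → Measure X}
    (hδ : ∀ φ : KWiseQuery X k, (#{s | Distinguishes τ D₀ (D s) φ} : ℝ) ≤ δ)
    {Good : S → H → Prop} {test : H → KWiseQuery X k}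
    (htest : ∀ s h, Good s h → Distinguishes τ D₀ (D s) (test h))
    {a : SQAlg X k H} {q : ℕ} (ha : ∀ s, a.numQueries (reluctantOracle τ D₀ (D s)) ≤ q) :
    (#{s | Good s (a.run (reluctantOracle τ D₀ (D s)))} : ℝ) ≤ (q + 1) * δ := by
  set h₀ := a.run (kWiseExpect D₀)
  set asked := (a.queries (kWiseExpect D₀)).take q
  set tried := (test h₀ :: asked).toFinset
  have hsub : ({s | Good s (a.run (reluctantOracle τ D₀ (D s)))} : Finset S) ⊆
      tried.biUnion fun φ => {s | Distinguishes τ D₀ (D s) φ} := by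
    intro s hs
    by_contra hn
    simp only [Finset.mem_biUnion, Finset.mem_filter_univ, not_exists, not_and] at hn
    rw [Finset.mem_filter_univ,
      run_reluctantOracle (ha s) fun φ hφ => hn φ (by simp [tried, asked, hφ])] at hs
    exact hn _ (by simp [tried]) (htest s h₀ hs)
  have hcard_tried : (#tried : ℝ) ≤ q + 1 := by
    have : #tried ≤ asked.length + 1 := List.toFinset_card_le _
    exact_mod_cast this.trans (Nat.succ_le_succ (List.length_take_le _ _))
  have hδ0 : 0 ≤ δ := (Nat.cast_nonneg _).trans (hδ (test h₀))
  calc (#{s | Good s (a.run (reluctantOracle τ D₀ (D s)))} : ℝ)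
      ≤ ∑ φ ∈ tried, (#{s | Distinguishes τ D₀ (D s) φ} : ℝ) := by
        exact_mod_cast (Finset.card_le_card hsub).trans Finset.card_biUnion_le
    _ ≤ #tried * δ := by simpa using Finset.sum_le_card_nsmul tried _ _ fun φ _ => hδ φ
    _ ≤ (q + 1) * δ := by gcongr

open Classical in
theorem exists_mul_card_le_card_filter_mem {Ω : Type*} [MeasurableSpace Ω] (μ : Measure Ω)
    [IsProbabilityMeasure μ] {E : S → Set Ω} (hE : ∀ s, MeasurableSet (E s)) {p : ℝ}
    (hp : ∀ s, p ≤ μ.real (E s)) : ∃ ω, p * Fintype.card S ≤ #{s | ω ∈ E s} := by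
  have hint (s : S) : Integrable ((E s).indicator (1 : Ω → ℝ)) μ :=
    (integrable_const 1).indicator (hE s)
  obtain ⟨ω, hω⟩ := exists_integral_le (integrable_finsetSum Finset.univ fun s _ => hint s)
  refine ⟨ω, ?_⟩
  calc p * Fintype.card S ≤ ∑ s, μ.real (E s) := by
        simpa [mul_comm] using Finset.card_nsmul_le_sum Finset.univ _ p fun s _ => hp s
    _ = ∫ ω, ∑ s, (E s).indicator (1 : Ω → ℝ) ω ∂μ := by
        simp only [integral_finsetSum _ fun s _ => hint s, integral_indicator_one (hE _)]
    _ ≤ #{s | ω ∈ E s} := hω.trans_eq (by simp [Set.indicator_apply])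

open Classical in
theorem PACLearns.le_mul_of_card_distinguishes_le {Z : Type} [MeasurableSpace Z] {Ω : Type*}
    [MeasurableSpace Ω] {C : Set (Z → Bool)} {τ ε p : ℝ} {μ : Measure Ω} [IsProbabilityMeasure μ]
    {A : Ω → SQAlg (Z × Bool) k (Z → Bool)} {q : ℕ} (hA : PACLearns C τ ε p μ A)
    (hq : UsesAtMost C τ A q) (hτ : 0 ≤ τ) [Nonempty S] {P : Measure Z} [IsProbabilityMeasure P]
    {f : S → Z → Bool} (hf : ∀ s, f s ∈ C) {D₀ : Measure (Z × Bool)} {δ : ℝ}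
    (hδ : ∀ φ : KWiseQuery (Z × Bool) k,
      (#{s | Distinguishes τ D₀ (labeled P (f s)) φ} : ℝ) ≤ δ * Fintype.card S)
    {test : (Z → Bool) → KWiseQuery (Z × Bool) k}
    (htest : ∀ s h, P.real {x | h x ≠ f s x} < ε →
      Distinguishes τ D₀ (labeled P (f s)) (test h)) :
    p ≤ (q + 1) * δ := by
  have hO (s : S) : IsSTAT k (labeled P (f s)) τ (reluctantOracle τ D₀ (labeled P (f s))) :=
    isSTAT_reluctantOracle hτ D₀ _
  choose E hE_meas hE_prob hE_success using fun s => hA P (f s) (hf s) _ (hO s)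
  obtain ⟨ω, hω⟩ := exists_mul_card_le_card_filter_mem μ hE_meas hE_prob
  let Good (s : S) (h : Z → Bool) : Prop := P.real {x | h x ≠ f s x} < ε
  have hgood : #{s | ω ∈ E s} ≤
      #{s | Good s ((A ω).run (reluctantOracle τ D₀ (labeled P (f s))))} :=
    Finset.card_le_card (Finset.monotone_filter_right _ fun s _ hs => hE_success s ω hs)
  have hcard : p * Fintype.card S ≤ (q + 1) * δ * Fintype.card S :=
    calc p * Fintype.card S ≤ #{s | ω ∈ E s} := hω
      _ ≤ #{s | Good s ((A ω).run (reluctantOracle τ D₀ (labeled P (f s))))} := by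
          exact_mod_cast hgood
      _ ≤ (q + 1) * (δ * Fintype.card S) :=
          SQAlg.card_run_reluctantOracle_le hδ htest fun s => hq P (f s) (hf s) _ (hO s) ω
      _ = (q + 1) * δ * Fintype.card S := by ring
  exact le_of_mul_le_mul_right hcard (Nat.cast_pos.2 Fintype.card_pos)

end QueryLowerBound

section RandomLabels

open scoped NNReal Finset

theorem card_lt_abs_mul_pow_le {S : Type*} [Fintype S] (X : S → ℝ) {τ : ℝ} (hτ : 0 ≤ τ) {e : ℕ}
    (he : Even e) : #{s | τ < |X s|} * τ ^ e ≤ ∑ s, X s ^ e :=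
  calc #{s | τ < |X s|} * τ ^ e ≤ ∑ s with τ < |X s|, X s ^ e := by
        rw [← nsmul_eq_mul]
        refine Finset.card_nsmul_le_sum _ _ _ fun s hs => ?_
        rw [← he.pow_abs (X s)]
        exact pow_le_pow_left₀ hτ ((Finset.mem_filter_univ s).1 hs).le e
    _ ≤ ∑ s, X s ^ e := Finset.sum_le_univ_sum_of_nonneg fun s => he.pow_nonneg _

variable {Z : Type}

/-- The query whose expectation is the error of the hypothesis `h`. -/
noncomputable def errorQuery {k : ℕ} [NeZero k] (h : Z → Bool) : KWiseQuery (Z × Bool) k :=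
  fun y => if h (y 0).1 = (y 0).2 then ⟨0, by norm_num⟩ else ⟨1, by norm_num⟩

variable [MeasurableSpace Z]

/-- The distribution of `(x, b)` for `x ∼ P` and an independent uniformly random label `b`: the
reference distribution from which the labeled examples are to be distinguished. -/
noncomputable def uniformlyLabeled (P : Measure Z) : Measure (Z × Bool) :=
  (2⁻¹ : ℝ≥0) • (labeled P (fun _ => false) + labeled P fun _ => true)

variable [DiscreteMeasurableSpace Z]

section Measure

variable (P : Measure Z) (f : Z → Bool)

instance isProbabilityMeasure_labeled [IsProbabilityMeasure P] :
    IsProbabilityMeasure (labeled P f) :=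
  Measure.isProbabilityMeasure_map Measurable.of_discrete.aemeasurable

theorem integral_labeled {ψ : Z × Bool → ℝ} (hψ : Measurable ψ) :
    ∫ y, ψ y ∂(labeled P f) = ∫ x, ψ (x, f x) ∂P :=
  integral_map Measurable.of_discrete.aemeasurable hψ.aestronglyMeasurable

theorem uniformlyLabeled_eq :
    uniformlyLabeled P = (2⁻¹ : ℝ≥0) • (labeled P f + labeled P fun x => !f x) := by
  rw [uniformlyLabeled]
  congr 1
  refine Measure.ext_of_lintegral _ fun g hg => ?_
  simp only [labeled, lintegral_add_measure, lintegral_map hg Measurable.of_discrete]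
  rw [← lintegral_add_left .of_discrete, ← lintegral_add_left .of_discrete]
  refine lintegral_congr fun x => ?_
  cases f x
  · rfl
  · exact add_comm _ _

instance isProbabilityMeasure_uniformlyLabeled [IsProbabilityMeasure P] :
    IsProbabilityMeasure (uniformlyLabeled P) where
  measure_univ := by
    simp [uniformlyLabeled, ENNReal.smul_def, ENNReal.inv_two_add_inv_two]

theorem labeled_le_two_smul_uniformlyLabeled : labeled P f ≤ (2 : ℝ≥0) • uniformlyLabeled P := by
  rw [uniformlyLabeled_eq P f, smul_smul, mul_inv_cancel₀ two_ne_zero, one_smul]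
  exact Measure.le_add_right le_rfl

theorem integral_labeled_sub_integral_uniformlyLabeled [IsProbabilityMeasure P] {ψ : Z × Bool → ℝ}
    (hψm : Measurable ψ) (hψ : ∀ y, |ψ y| ≤ 1) :
    ∫ y, ψ y ∂(labeled P f) - ∫ y, ψ y ∂(uniformlyLabeled P) =
      ∫ x, (ψ (x, false) - ψ (x, true)) / 2 * boolSign (f x) ∂P := by
  have hint (g : Z → Bool) : Integrable (fun x => ψ (x, g x)) P :=
    integrable_of_abs_le .of_discrete fun _ => hψ _
  rw [uniformlyLabeled_eq P f, integral_smul_nnreal_measure, integral_add_measure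
    (integrable_of_abs_le hψm hψ) (integrable_of_abs_le hψm hψ)]
  simp only [integral_labeled P _ hψm]
  calc ∫ x, ψ (x, f x) ∂P - (2⁻¹ : ℝ≥0) • (∫ x, ψ (x, f x) ∂P + ∫ x, ψ (x, !f x) ∂P)
      = (∫ x, ψ (x, f x) ∂P - ∫ x, ψ (x, !f x) ∂P) / 2 := by
        rw [NNReal.smul_def, smul_eq_mul]; push_cast; ring
    _ = ∫ x, (ψ (x, f x) - ψ (x, !f x)) / 2 ∂P := by
        rw [integral_div, integral_sub (hint f) (hint fun x => !f x)]
    _ = _ := integral_congr_ae (.of_forall fun x => by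
        dsimp only
        cases f x <;> simp [boolSign, sub_div])

end Measure

variable [Countable Z]

theorem kWiseExpect_errorQuery {k : ℕ} [NeZero k] (D : Measure (Z × Bool))
    [IsProbabilityMeasure D] (h : Z → Bool) :
    kWiseExpect D (errorQuery h : KWiseQuery (Z × Bool) k) = D.real {y | h y.1 ≠ y.2} := by
  rw [kWiseExpect, ← integral_indicator_one .of_discrete,
    ← integral_comp_eval (μ := fun _ : Fin k => D) (i := 0)
      Measurable.of_discrete.aestronglyMeasurable]
  refine integral_congr_ae (.of_forall fun y => ?_)
  by_cases hy : h (y 0).1 = (y 0).2 <;> simp [errorQuery, hy]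

theorem labeled_real_error (P : Measure Z) (f h : Z → Bool) :
    (labeled P f).real {y | h y.1 ≠ y.2} = P.real {x | h x ≠ f x} :=
  map_measureReal_apply .of_discrete .of_discrete

theorem uniformlyLabeled_real_error (P : Measure Z) [IsProbabilityMeasure P]
    (h : Z → Bool) : (uniformlyLabeled P).real {y | h y.1 ≠ y.2} = 1 / 2 := by
  rw [uniformlyLabeled_eq P h, measureReal_nnreal_smul_apply, measureReal_add_apply,
    labeled_real_error, labeled_real_error]
  simp

theorem sum_pow_kWiseExpect_labeled_sub_le {S : Type*} [Fintype S] {P : Measure Z}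
    [IsProbabilityMeasure P] {f : S → Z → Bool} {e : ℕ} (he : Even e) (he0 : e ≠ 0) {B : ℝ}
    (hB : ∀ ψ : Z → ℝ, (∀ x, |ψ x| ≤ 1) → ∑ s, (∫ x, ψ x * boolSign (f s x) ∂P) ^ e ≤ B)
    {k : ℕ} (φ : KWiseQuery (Z × Bool) k) :
    ∑ s, (kWiseExpect (labeled P (f s)) φ - kWiseExpect (uniformlyLabeled P) φ) ^ e ≤
      k ^ e * (2 ^ k * B) := by
  have hbase (ψ : Z × Bool → ℝ) (hψm : Measurable ψ) (hψ : ∀ y, |ψ y| ≤ 1) :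
      ∑ s, (∫ y, ψ y ∂(labeled P (f s)) - ∫ y, ψ y ∂(uniformlyLabeled P)) ^ e ≤ B := by
    simp only [integral_labeled_sub_integral_uniformlyLabeled P _ hψm hψ]
    refine hB _ fun x => ?_
    rw [abs_div, abs_two, div_le_one two_pos]
    exact (abs_sub _ _).trans (by linarith [hψ (x, false), hψ (x, true)])
  simpa using! sum_pow_integral_pi_sub_le (one_le_two (α := ℝ≥0))
    (fun s => labeled_le_two_smul_uniformlyLabeled P (f s)) he he0 hbase
    (Measurable.of_discrete (f := fun y => (φ y : ℝ))) fun y => abs_le.2 (φ y).2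

theorem PACLearns.le_mul_of_sum_pow_correlation_le {Ω : Type*} [MeasurableSpace Ω]
    {k : ℕ} [NeZero k] {C : Set (Z → Bool)} {τ p : ℝ} {μ : Measure Ω} [IsProbabilityMeasure μ]
    {A : Ω → SQAlg (Z × Bool) k (Z → Bool)} {q : ℕ} (hA : PACLearns C τ (1 / 2 - τ) p μ A)
    (hq : UsesAtMost C τ A q) (hτ : 0 < τ) {S : Type*} [Fintype S] [Nonempty S] {P : Measure Z}
    [IsProbabilityMeasure P] {f : S → Z → Bool} (hf : ∀ s, f s ∈ C) {e : ℕ} (he : Even e)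
    (he0 : e ≠ 0) {B : ℝ} (hB : ∀ ψ : Z → ℝ, (∀ x, |ψ x| ≤ 1) →
      ∑ s, (∫ x, ψ x * boolSign (f s x) ∂P) ^ e ≤ B * Fintype.card S) :
    p ≤ (q + 1) * (k ^ e * 2 ^ k * B / τ ^ e) := by
  refine hA.le_mul_of_card_distinguishes_le hq hτ.le (P := P) hf (D₀ := uniformlyLabeled P)
    (test := errorQuery) (fun φ => ?_) fun s h hh => ?_
  · have hmarkov := (card_lt_abs_mul_pow_le (fun s => kWiseExpect (labeled P (f s)) φ -
      kWiseExpect (uniformlyLabeled P) φ) hτ.le he).trans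
        (sum_pow_kWiseExpect_labeled_sub_le he he0 hB φ)
    simp only [Distinguishes, abs_sub_comm (kWiseExpect (uniformlyLabeled P) φ)]
    rw [div_mul_eq_mul_div, le_div_iff₀ (pow_pos hτ e)]
    exact hmarkov.trans_eq (by ring)
  · rw [Distinguishes, kWiseExpect_errorQuery, kWiseExpect_errorQuery, labeled_real_error,
      uniformlyLabeled_real_error]
    exact (by linarith : τ < _).trans_le (le_abs_self _)

end RandomLabels

namespace BlockParity

open scoped NNReal

variable {ι κ : Type*} [Fintype ι] {n : ℕ} (v : ι × κ ↪ Fin n)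

/-- The parity of a family of bits. -/
def parity (b : ι → Bool) : Bool :=
  decide (Odd (Finset.univ.filter fun j => b j).card)

theorem boolSign_parity (b : ι → Bool) : boolSign (parity b) = ∏ j, boolSign (b j) := by
  rw [prod_boolSign]
  by_cases h : Odd (Finset.univ.filter fun j => b j).card
  · simp [parity, boolSign, h, h.neg_one_pow]
  · simp [parity, boolSign, h, (Nat.not_odd_iff_even.1 h).neg_one_pow]

/-- The input that encodes the choice of one index `c j` in each block `j`, where `v (j, i)` is the
variable of index `i` in block `j`: exactly the chosen variables are false. -/
def encode (c : ι → κ) : Fin n → Bool :=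
  fun w => decide (∀ j, w ≠ v (j, c j))

theorem encode_apply_eq_true_iff (c : ι → κ) (j : ι) (i : κ) :
    encode v c (v (j, i)) = true ↔ i ≠ c j := by
  simp only [encode, decide_eq_true_eq, ne_eq, v.injective.eq_iff, Prod.mk.injEq, not_and]
  exact ⟨fun h => h j rfl, fun h j' hj => hj ▸ h⟩

variable [Fintype κ]

/-- The term asserting, on encodings, that `b` is the family of the bits of the secret `s` at the
chosen indices: no index with another bit is chosen. -/
def blockTerm (s : ι → κ → Bool) (b : ι → Bool) : Finset (Fin n × Bool) :=
  (Finset.univ.filter fun ji : ι × κ => s ji.1 ji.2 ≠ b ji.1).image fun ji => (v ji, true)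

theorem blockTerm_satisfied_iff (s : ι → κ → Bool) (b : ι → Bool) (c : ι → κ) :
    (∀ l ∈ blockTerm v s b, encode v c l.1 = l.2) ↔ b = fun j => s j (c j) := by
  simp only [blockTerm, Finset.forall_mem_image, Finset.mem_filter_univ, Prod.forall,
    encode_apply_eq_true_iff]
  constructor
  · intro h
    funext j
    by_contra hj
    exact h j (c j) (Ne.symm hj) rfl
  · rintro rfl j i hi rfl
    exact hi rfl

variable [DecidableEq ι]

/-- A DNF formula that computes, on encodings, the function `g` of the bits of the secret `s` at
the chosen indices. -/
def formula (g : (ι → Bool) → Bool) (s : ι → κ → Bool) : DNF n :=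
  (Finset.univ.filter fun b => g b).image (blockTerm v s)

theorem eval_formula_encode (g : (ι → Bool) → Bool) (s : ι → κ → Bool) (c : ι → κ) :
    (formula v g s).eval (encode v c) = g fun j => s j (c j) := by
  simp only [DNF.eval, formula, Finset.exists_mem_image, blockTerm_satisfied_iff]
  simp

theorem size_formula_le (g : (ι → Bool) → Bool) (s : ι → κ → Bool) :
    (formula v g s).size ≤ 2 ^ Fintype.card ι :=
  (Finset.card_image_le.trans (Finset.card_filter_le _ _)).trans_eq (by simp)

/-- The distribution of the encoding of uniformly random indices. -/
noncomputable def inputs : Measure (Fin n → Bool) :=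
  (Fintype.card (ι → κ) : ℝ≥0)⁻¹ • ∑ c, Measure.dirac (encode v c)

instance isProbabilityMeasure_inputs [Nonempty κ] : IsProbabilityMeasure (inputs v) where
  measure_univ := by
    simp [inputs, ENNReal.smul_def, ENNReal.inv_mul_cancel]

theorem integral_inputs (g : (Fin n → Bool) → ℝ) :
    ∫ x, g x ∂(inputs v) = (∑ c, g (encode v c)) / Fintype.card κ ^ Fintype.card ι := by
  rw [inputs, integral_smul_nnreal_measure, integral_finsetSum_measure fun _ _ => .of_finite]
  simp [NNReal.smul_def, div_eq_inv_mul]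

theorem sum_pow_correlation_le [DecidableEq κ] [Nonempty κ] (t : ℕ) {ψ : (Fin n → Bool) → ℝ}
    (hψ : ∀ x, |ψ x| ≤ 1) :
    ∑ s : ι → κ → Bool, (∫ x, ψ x * boolSign ((formula v parity s).eval x) ∂(inputs v)) ^ (2 * t) ≤
      (6 * t / Fintype.card κ : ℝ) ^ (t * Fintype.card ι) * Fintype.card (ι → κ → Bool) := by
  set r := Fintype.card ι with hr
  set m : ℝ := (Fintype.card κ : ℝ) with hm
  have hm0 : 0 < m := Nat.cast_pos.2 Fintype.card_pos
  calc _ = (∑ s : ι → κ → Bool, (∑ c, ψ (encode v c) * ∏ j, boolSign (s j (c j))) ^ (2 * t)) /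
        (m ^ r) ^ (2 * t) := by
        simp only [integral_inputs, eval_formula_encode, boolSign_parity, ← Finset.sum_div,
          div_pow, hm, hr]
    _ ≤ (2 ^ Fintype.card κ * (6 * t * m) ^ t) ^ r / (m ^ r) ^ (2 * t) := by
        gcongr
        refine (sum_pow_sum_mul_prod_boolSign_le (fun c => hψ _) _).trans ?_
        exact pow_le_pow_left₀ (Finset.sum_nonneg fun u _ => (even_two_mul t).pow_nonneg _)
          (sum_pow_two_mul_sum_boolSign_le t) _
    _ = _ := by
        have hcard : (Fintype.card (ι → κ → Bool) : ℝ) = (2 ^ Fintype.card κ) ^ r := by simp [hr]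
        have hscale : 6 * t * m = 6 * t / m * m ^ 2 := by field_simp
        rw [hcard, hscale, div_eq_iff (by positivity)]
        generalize 6 * t / m = x
        ring

end BlockParity

theorem PACLearns.le_mul_of_dnf {n r m k : ℕ} [NeZero k] [NeZero m] (hr : 2 ^ r ≤ n)
    (hrm : r * m ≤ n) {Ω : Type*} [MeasurableSpace Ω] {μ : Measure Ω} [IsProbabilityMeasure μ]
    {A : Ω → SQAlg ((Fin n → Bool) × Bool) k ((Fin n → Bool) → Bool)} {q : ℕ} {τ p : ℝ}
    (hA : PACLearns (DNF.conceptClass n n) τ (1 / 2 - τ) p μ A)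
    (hq : UsesAtMost (DNF.conceptClass n n) τ A q) (hτ : 0 < τ) :
    p ≤ (q + 1) * (2 * k ^ 2 * (6 * k / m) ^ r / τ ^ 2) ^ k := by
  let v : Fin r × Fin m ↪ Fin n := finProdFinEquiv.toEmbedding.trans (Fin.castLEEmb hrm)
  have hcard (s) : (BlockParity.formula v BlockParity.parity s).size ≤ n :=
    (BlockParity.size_formula_le v _ s).trans (by simpa using hr)
  have h := hA.le_mul_of_sum_pow_correlation_le hq hτ (P := BlockParity.inputs v)
    (fun s => ⟨_, hcard s, rfl⟩) (even_two_mul k) (by simp [NeZero.ne])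
    fun ψ hψ => BlockParity.sum_pow_correlation_le v k hψ
  simp only [Fintype.card_fin] at h
  refine h.trans_eq ?_
  generalize (6 * k / m : ℝ) = x
  ring

theorem PACLearns.two_pow_le_of_dnf {n r m k : ℕ} [NeZero k] [NeZero m] (hr : 2 ^ r ≤ n)
    (hrm : r * m ≤ n) {Ω : Type*} [MeasurableSpace Ω] {μ : Measure Ω} [IsProbabilityMeasure μ]
    {A : Ω → SQAlg ((Fin n → Bool) × Bool) k ((Fin n → Bool) → Bool)} {q : ℕ} {τ : ℝ}
    (hA : PACLearns (DNF.conceptClass n n) τ (1 / 2 - τ) (2 / 3) μ A)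
    (hq : UsesAtMost (DNF.conceptClass n n) τ A q) (hτ : 0 < τ)
    (hsmall : 2 * k ^ 2 * (6 * k / m) ^ r / τ ^ 2 ≤ 1 / 16) : (2 : ℝ) ^ k ≤ q := by
  have h16 : 2 / 3 * (2 ^ k * 8 ^ k : ℝ) ≤ q + 1 := by
    rw [← mul_pow, ← le_div_iff₀ (by positivity)]
    calc (2 / 3 : ℝ) ≤ (q + 1) * (2 * k ^ 2 * (6 * k / m) ^ r / τ ^ 2) ^ k :=
          hA.le_mul_of_dnf hr hrm hq hτ
      _ ≤ (q + 1) * (1 / 16) ^ k := by gcongr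
      _ = (q + 1) / (2 * 8) ^ k := by rw [one_div_pow, mul_one_div]; norm_num
  have h8 : (8 : ℝ) ≤ 8 ^ k := le_self_pow₀ (by norm_num) (NeZero.ne k)
  nlinarith [one_le_pow₀ (one_le_two (α := ℝ)) (n := k)]

section Asymptotics

open Filter

theorem lt_two_mul_mul_div {n r : ℕ} (hr : 0 < r) (hrn : r ≤ n) : n < 2 * (r * (n / r)) := by
  have h := Nat.le_mul_of_pos_right r (Nat.div_pos hrn hr)
  have := Nat.lt_mul_div_succ n hr
  rw [mul_add_one] at this
  omega

theorem le_two_mul_logb_mul_div_log {n : ℕ} (hn : 2 ≤ n) :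
    (n : ℝ) ≤ 2 * Real.logb 2 n * (n / Nat.log 2 n : ℕ) := by
  have h := lt_two_mul_mul_div (Nat.log_pos one_lt_two hn) (Nat.log_le_self 2 n)
  calc (n : ℝ) ≤ 2 * Nat.log 2 n * (n / Nat.log 2 n : ℕ) := by
        rw [mul_assoc]
        exact_mod_cast h.le
    _ ≤ _ := by gcongr; exact Real.natLog_le_logb n 2

theorem logb_div_two_le_natLog {n : ℕ} (hn : 2 ≤ Real.logb 2 n) :
    Real.logb 2 n / 2 ≤ Nat.log 2 n := by
  have h : Real.logb 2 n < Nat.log 2 n + 1 := by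
    rw [← Real.natFloor_logb_natCast, Nat.cast_ofNat]
    exact Nat.lt_floor_add_one _
  linarith

theorem six_mul_div_le_rpow {n k m L a : ℝ} (hn : 0 < n) (hm : 0 < m) (hk : k ≤ 2 * n ^ (1 - a))
    (hnm : n ≤ 2 * L * m) (hL : 24 * L ≤ n ^ (a / 2)) : 6 * k / m ≤ n ^ (-(a / 2)) := by
  rw [div_le_iff₀ hm]
  calc 6 * k ≤ 12 * n ^ (-a) * n := by
        rw [mul_assoc, ← Real.rpow_add_one hn.ne', neg_add_eq_sub]
        linarith
    _ ≤ 12 * n ^ (-a) * (2 * L * m) := by gcongr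
    _ = n ^ (-a) * (24 * L) * m := by ring
    _ ≤ n ^ (-a) * n ^ (a / 2) * m := by gcongr
    _ = n ^ (-(a / 2)) * m := by rw [← Real.rpow_add hn]; ring_nf

theorem two_mul_sq_mul_pow_div_sq_le {n k x L a β : ℝ} {r : ℕ} (hn : 2 ≤ n) (hk0 : 0 ≤ k)
    (hk : k ≤ 2 * n) (hx0 : 0 ≤ x) (hx : x ≤ n ^ (-(a / 2))) (ha : 0 ≤ a) (hr : L / 2 ≤ r)
    (haL : 72 ≤ a * L) (hβ : β ≤ a / 16) :
    2 * k ^ 2 * x ^ r / (n ^ (-(β * L))) ^ 2 ≤ 1 / 16 := by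
  have hn0 : 0 < n := by linarith
  have hn1 : 1 ≤ n := by linarith
  have hL : 0 < L := pos_of_mul_pos_right (by linarith) ha
  have h2k : 2 * k ^ 2 ≤ n ^ 9 / 16 :=
    calc 2 * k ^ 2 ≤ 2 * (2 * n) ^ 2 := by gcongr
      _ = 2 ^ 7 * n ^ 2 / 16 := by ring
      _ ≤ n ^ 7 * n ^ 2 / 16 := by gcongr
      _ = n ^ 9 / 16 := by ring
  have hxr : x ^ r ≤ n ^ (-(a * L / 4)) :=
    calc x ^ r ≤ (n ^ (-(a / 2))) ^ r := by gcongr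
      _ = n ^ (-(a / 2) * r) := by rw [Real.rpow_mul hn0.le, Real.rpow_natCast]
      _ ≤ n ^ (-(a * L / 4)) := Real.rpow_le_rpow_of_exponent_le hn1 (by nlinarith)
  rw [div_le_iff₀ (by positivity)]
  calc 2 * k ^ 2 * x ^ r ≤ n ^ 9 / 16 * n ^ (-(a * L / 4)) := by gcongr
    _ = 1 / 16 * n ^ (9 - a * L / 4) := by
        rw [sub_eq_add_neg, Real.rpow_add hn0, ← Real.rpow_natCast]
        push_cast
        ring
    _ ≤ 1 / 16 * n ^ (-(β * L) * 2) := by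
        gcongr 1 / 16 * ?_
        exact Real.rpow_le_rpow_of_exponent_le hn1 (by nlinarith)
    _ = 1 / 16 * (n ^ (-(β * L))) ^ 2 := by rw [Real.rpow_mul hn0.le, Real.rpow_two]

theorem eventually_mul_logb_le_rpow {b c : ℝ} (hb : 0 < b) (hc : 0 < c) :
    ∀ᶠ x in atTop, c * Real.logb 2 x ≤ x ^ b := by
  have hlog2 : 0 < Real.log 2 := Real.log_pos one_lt_two
  filter_upwards [(isLittleO_log_rpow_atTop hb).bound (div_pos hlog2 hc), eventually_ge_atTop 0]
    with x hx hx0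
  rw [Real.norm_of_nonneg (Real.rpow_nonneg hx0 b), div_mul_eq_mul_div, le_div_iff₀' hc] at hx
  rw [Real.logb, ← mul_div_assoc, div_le_iff₀' hlog2]
  exact (mul_le_mul_of_nonneg_left (Real.le_norm_self _) hc.le).trans hx

theorem eventually_exists_blocks {a : ℝ} (ha : 0 < a) :
    ∀ᶠ n : ℕ in atTop, ∀ β ≤ a / 16, ∀ k : ℕ, (k : ℝ) ≤ 2 * (n : ℝ) ^ (1 - a) →
      ∃ r m : ℕ, 0 < m ∧ 2 ^ r ≤ n ∧ r * m ≤ n ∧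
        2 * (k : ℝ) ^ 2 * (6 * k / m) ^ r / ((n : ℝ) ^ (-(β * Real.logb 2 n))) ^ 2 ≤ 1 / 16 := by
  have hcast := tendsto_natCast_atTop_atTop (R := ℝ)
  have hlog := (Real.tendsto_logb_atTop one_lt_two).comp hcast
  filter_upwards [eventually_ge_atTop 2, hlog.eventually_ge_atTop 2,
    hlog.eventually_ge_atTop (72 / a),
    hcast.eventually (eventually_mul_logb_le_rpow (half_pos ha) (c := 24) (by norm_num))]
    with n hn hL haL hLa β hβ k hk
  have hn2 : (2 : ℝ) ≤ n := by exact_mod_cast hn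
  have hm : 0 < n / Nat.log 2 n := Nat.div_pos (Nat.log_le_self 2 n) (Nat.log_pos one_lt_two hn)
  refine ⟨Nat.log 2 n, n / Nat.log 2 n, hm, Nat.pow_log_le_self 2 (by omega),
    Nat.mul_div_le n _, ?_⟩
  have hkn : (k : ℝ) ≤ 2 * n := by
    refine hk.trans ?_
    gcongr
    exact Real.rpow_le_self_of_one_le (by linarith) (by linarith)
  exact two_mul_sq_mul_pow_div_sq_le hn2 k.cast_nonneg hkn (by positivity)
    (six_mul_div_le_rpow (by linarith) (Nat.cast_pos.2 hm) hk (le_two_mul_logb_mul_div_log hn) hLa)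
    ha.le (logb_div_two_le_natLog hL) ((div_le_iff₀' ha).1 haL) hβ

theorem half_le_rpow_neg_mul_logb {x y β : ℝ} (hx : 1 ≤ x) (hxy : x ≤ y) (hβ0 : 0 ≤ β)
    (hβ : β * Real.logb 2 y ^ 2 ≤ 1) : 1 / 2 ≤ x ^ (-(β * Real.logb 2 x)) := by
  have hx0 : 0 < x := one_pos.trans_le hx
  have hlog : Real.logb 2 x ≤ Real.logb 2 y := Real.logb_le_logb_of_le one_lt_two hx0 hxy
  have hβx : β * Real.logb 2 x ^ 2 ≤ 1 := le_trans (by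
    have := Real.logb_nonneg one_lt_two hx
    gcongr) hβ
  calc (1 / 2 : ℝ) = 2 ^ (-1 : ℝ) := by rw [Real.rpow_neg_one, one_div]
    _ ≤ 2 ^ (Real.logb 2 x * -(β * Real.logb 2 x)) :=
        Real.rpow_le_rpow_of_exponent_le one_le_two (by linarith)
    _ = x ^ (-(β * Real.logb 2 x)) := by
        rw [Real.rpow_mul zero_le_two, Real.rpow_logb two_pos one_lt_two.ne' hx0]

theorem natCeil_rpow_le {x b c : ℝ} (hx : 1 ≤ x) (hbc : b ≤ c) (hc : 0 ≤ c) :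
    (⌈x ^ b⌉₊ : ℝ) ≤ 2 * x ^ c := by
  have hceil := (Nat.ceil_lt_add_one (Real.rpow_nonneg (zero_le_one.trans hx) b)).le
  linarith [Real.rpow_le_rpow_of_exponent_le hx hbc, Real.one_le_rpow hx hc]

end Asymptotics

theorem PACLearns.error_pos {Z : Type} [MeasurableSpace Z] [Nonempty Z] {Ω : Type*}
    [MeasurableSpace Ω] {k : ℕ} {C : Set (Z → Bool)} (hC : C.Nonempty) {τ ε p : ℝ} (hτ : 0 ≤ τ)
    (hp : 0 < p) {μ : Measure Ω} {A : Ω → SQAlg (Z × Bool) k (Z → Bool)}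
    (hA : PACLearns C τ ε p μ A) : 0 < ε := by
  obtain ⟨f, hf⟩ := hC
  obtain ⟨z⟩ := ‹Nonempty Z›
  obtain ⟨E, -, hE, hsuccess⟩ := hA (Measure.dirac z) f hf
    (kWiseExpect (labeled (Measure.dirac z) f)) fun φ => by simpa [kWiseExpect] using hτ
  obtain ⟨ω, hω⟩ : E.Nonempty := nonempty_of_measureReal_ne_zero (hp.trans_le hE).ne'
  exact measureReal_nonneg.trans_lt (hsuccess ω hω)

theorem theorem3 (α : ℝ) (hα : 0 < α) :
    ∃ β : ℝ, 0 < β ∧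
      ∀ n : ℕ, 1 ≤ n →
        ∀ (Ω : Type*) [MeasurableSpace Ω] (μ : Measure Ω) [IsProbabilityMeasure μ]
          (A : Ω → SQAlg ((Fin n → Bool) × Bool) ⌈(n : ℝ) ^ (1 - α)⌉₊ ((Fin n → Bool) → Bool))
          (q : ℕ),
          PACLearns (DNF.conceptClass n n) ((n : ℝ) ^ (-(β * Real.logb 2 n)))
            (1 / 2 - (n : ℝ) ^ (-(β * Real.logb 2 n))) (2 / 3) μ A →
          UsesAtMost (DNF.conceptClass n n) ((n : ℝ) ^ (-(β * Real.logb 2 n))) A q →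
          (2 : ℝ) ^ ((n : ℝ) ^ (1 - α)) ≤ q := by
  have ha : 0 < min α 1 := lt_min hα one_pos
  obtain ⟨N, hblocks⟩ := Filter.eventually_atTop.1 (eventually_exists_blocks ha)
  have hlogN : 0 < Real.logb 2 (N + 2 : ℕ) := Real.logb_pos one_lt_two (by norm_cast; omega)
  set β := min (min α 1 / 16) (1 / Real.logb 2 (N + 2 : ℕ) ^ 2)
  have hβ : 0 < β := lt_min (by positivity) (by positivity)
  refine ⟨β, hβ, fun n hn Ω _ μ _ A q hA hq => ?_⟩
  have hn1 : (1 : ℝ) ≤ n := Nat.one_le_cast.2 hn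
  have hτ : 0 < (n : ℝ) ^ (-(β * Real.logb 2 n)) := Real.rpow_pos_of_pos (by linarith) _
  rcases le_total n (N + 2) with hnN | hnN
  · have hclass : (DNF.conceptClass n n).Nonempty := ⟨_, ∅, Nat.zero_le _, rfl⟩
    have herror := hA.error_pos hclass hτ.le (by norm_num)
    have hhalf := half_le_rpow_neg_mul_logb hn1 (Nat.cast_le.2 hnN) hβ.le
      ((le_div_iff₀ (by positivity)).1 (min_le_right _ _))
    linarith
  · have hk := natCeil_rpow_le hn1 (sub_le_sub_left (min_le_left α 1) 1) (by simp)
    obtain ⟨r, m, hm, hr, hrm, hsmall⟩ := hblocks n (by omega) β (min_le_left _ _) _ hk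
    have : NeZero m := ⟨hm.ne'⟩
    have : NeZero ⌈(n : ℝ) ^ (1 - α)⌉₊ := ⟨(Nat.ceil_pos.2 (by positivity)).ne'⟩
    refine le_trans ?_ (hA.two_pow_le_of_dnf hr hrm hq hτ hsmall)
    rw [← Real.rpow_natCast]
    exact Real.rpow_le_rpow_of_exponent_le one_le_two (Nat.le_ceil _)
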